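/- Let $G_1$ and $G_2$ be finite simple undirected graphs, each with at least one vertex, where $G_1$ is $r_1$-regular with $n_1$ vertices and $m_1$ edges, and $G_2$ is arbitrary with $n_2$ vertices. The subdivision-vertex join $G_1\dot\vee G_2$ is the graph obtained from the disjoint union of $G_2$ and the subdivision graph $\mathcal S(G_1)$ (the graph obtained from $G_1$ by inserting a new vertex into every edge) by joining each vertex of $V(G_1)$ with every vertex of $V(G_2)$. For a graph $G$ on $n$ vertices let $t(G)$ be the number of its spanning trees, and let $0=\mu_1(G)\le\mu_2(G)\le\cdots\le\mu_n(G)$ be the eigenvalues, with multiplicity, of its Laplacian matrix $L(G)=D(G)-A(G)$. Then $$t(G_1\dot\vee G_2)=\frac{2^{m_1-n_1}\,(2n_1+2n_2+n_1r_1)\,\prod_{i=2}^{n_2}\bigl(n_1+\mu_i(G_2)\bigr)\,\prod_{i=2}^{n_1}\bigl(2n_2+\mu_i(G_1)\bigr)}{m_1+n_1+n_2}.$$ -/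

import Mathlib

namespace SimpleGraph

universe u v

/-- The subdivision graph `S(G)`: one new vertex is inserted into every edge of `G`. Its vertices
are the vertices of `G` (left summand) and the inserted vertices, one for each edge of `G` (right
summand); the vertex inserted into `e` is adjacent exactly to the two ends of `e`. -/
def subdivision {V : Type u} (G : SimpleGraph V) : SimpleGraph (V ⊕ G.edgeSet) where
  Adj
    | .inl x, .inr e => x ∈ e.1
    | .inr e, .inl x => x ∈ e.1
    | .inl _, .inl _ => False
    | .inr _, .inr _ => False
  symm := ⟨by rintro (x | e) (y | f) h <;> exact h⟩
  loopless := ⟨by rintro (x | e) h <;> exact h⟩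

/-- The subdivision-vertex join of `G₁` and `G₂`: the disjoint union of `S(G₁)` and `G₂`, in which
moreover each vertex of `G₁` (but no inserted vertex) is joined with every vertex of `G₂`. -/
def subdivisionVertexJoin {V : Type u} {W : Type v} (G₁ : SimpleGraph V) (G₂ : SimpleGraph W) :
    SimpleGraph ((V ⊕ G₁.edgeSet) ⊕ W) where
  Adj
    | .inl a, .inl b => G₁.subdivision.Adj a b
    | .inr x, .inr y => G₂.Adj x y
    | .inl (.inl _), .inr _ => True
    | .inr _, .inl (.inl _) => True
    | .inl (.inr _), .inr _ => False
    | .inr _, .inl (.inr _) => False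
  symm := ⟨by
    rintro ((x | e) | y) ((x' | e') | y') h
    all_goals first
      | exact h
      | exact (show G₁.subdivision.Adj _ _ from h).symm
      | exact (show G₂.Adj _ _ from h).symm⟩
  loopless := ⟨by
    rintro (a | y) h
    · exact G₁.subdivision.irrefl h
    · exact G₂.irrefl h⟩

/-- The number `t(G)` of spanning trees of `G`: the subgraphs of `G` on all the vertices of `G`
that are trees. -/
noncomputable def spanningTreeCount {V : Type u} (G : SimpleGraph V) : ℕ :=
  {T : SimpleGraph V | T ≤ G ∧ T.IsTree}.ncard

/-- The eigenvalues of the Laplacian matrix of `G`, with multiplicity, in non-decreasing order. The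
eigenvalue `μᵢ(G)` with `1 ≤ i ≤ n` has the index `i - 1` in `Fin n`. (Mathlib's `eigenvalues₀`
lists them in non-increasing order.) -/
noncomputable def lapEigenvalue {V : Type u} [Fintype V] [DecidableEq V] (G : SimpleGraph V)
    [DecidableRel G.Adj] (i : Fin (Fintype.card V)) : ℝ :=
  (G.isHermitian_lapMatrix ℝ).eigenvalues₀ i.rev

end SimpleGraph

/-!
Let `L` be the Laplacian matrix of the join. Its rows sum to zero and its cofactors all equal the
number `t` of spanning trees, so `det (L + u vᵀ) = (∑ uᵢ) (∑ vᵢ) t` for all vectors `u`, `v`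
(`det_lapMatrix_add_vecMulVec`). With `u` the indicator of `V(G₂)` and `v` that of `V(G₁)`, the
left side is `n₁ n₂ t`, and the perturbation turns the block of `L` with rows in `V(G₂)` and columns
in `V(G₁)` from `-1` to `0`. The matrix is then block triangular. One diagonal block is
`n₁ + L(G₂)`; the other one belongs to the vertices of the subdivision graph, and the Schur
complement of its part `2 I` on the inserted vertices is `(2 n₂ + L(G₁)) / 2`, because
`R Rᵀ = D + A` for the incidence matrix `R` of `G₁`. Hence
`n₁ n₂ t = 2 ^ (m₁ - n₁) det (2 n₂ + L(G₁)) det (n₁ + L(G₂))`. The least Laplacian eigenvalue is `0`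
and contributes the factors `2 n₂` and `n₁` to these determinants. Regularity of `G₁` enters only
through `2 m₁ = n₁ r₁`, which makes `2 n₁ + 2 n₂ + n₁ r₁` twice the number `m₁ + n₁ + n₂`.

The cofactors are computed without the Cauchy–Binet formula. Replace row `r` of the Laplacian
matrix by `e_r`; every other row `v` is the sum of `e_v - e_w` over the neighbours `w` of `v`. By
multilinearity the determinant is a sum over the choices of one neighbour `f v` for every `v ≠ r`.
The summand is `1` if iterating `f` leads every vertex to `r`, and `0` otherwise
(`det_parentMatrix_of_reaches`, `det_parentMatrix_of_not_reaches`), and the choices of the first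
kind are the spanning trees, each vertex being sent to its parent
(`spanningTreeCount_eq_ncard_isParentMap`).
-/

/-! ### Determinants of rank-one perturbations -/

namespace Matrix

open Finset

variable {n R : Type*} [Fintype n] [DecidableEq n] [CommRing R]

/-- The determinant of a rank-one perturbation, expanded along the perturbed rows. -/
lemma det_add_vecMulVec_eq_sum_updateRow (A : Matrix n n R) (u v : n → R) :
    (A + vecMulVec u v).det = A.det + ∑ i, u i * (A.updateRow i v).det := by
  -- The rows are perturbed one after the other; `s` is the set of rows already treated.
  suffices H : ∀ s : Finset n,
      (A + vecMulVec (fun i ↦ if i ∈ s then u i else 0) v).det =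
        A.det + ∑ i ∈ s, u i * (A.updateRow i v).det by
    simpa using H univ
  intro s
  induction s using Finset.induction_on with
  | empty =>
    have : vecMulVec (fun _ : n ↦ (0 : R)) v = 0 := by ext; simp [vecMulVec_apply]
    simp [this]
  | insert k s hk ih =>
    set B := A + vecMulVec (fun i ↦ if i ∈ s then u i else 0) v with hB
    have hBk : B k = A k := by
      ext j; simp [hB, vecMulVec_apply, hk]
    have h1 : A + vecMulVec (fun i ↦ if i ∈ insert k s then u i else 0) v =
        B.updateRow k (A k + u k • v) := by
      ext i j
      by_cases hik : i = k
      · subst hik; simp [vecMulVec_apply]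
      · simp [hB, vecMulVec_apply, hik]
    have h2 : (B.updateRow k v).det = (A.updateRow k v).det := by
      refine det_eq_of_forall_row_eq_smul_add_const (fun i ↦ if i ∈ s then u i else 0) k
        (if_neg hk) fun i j ↦ ?_
      by_cases hik : i = k
      · subst hik; simp [hk]
      · simp [hB, vecMulVec_apply, updateRow_ne hik]
    rw [h1, det_updateRow_add, det_updateRow_smul, h2, ← hBk, updateRow_eq_self, ih,
      sum_insert hk]
    ring

end Matrix

namespace SimpleGraph

open Finset Matrix

/-! ### Spanning trees as parent maps -/

section ParentMap

variable {V : Type*} {r : V} {f g : V → V} {G T : SimpleGraph V}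

/-- The graph of a map `f : V → V`: every vertex `v` is joined with its image `f v`, where fixed
points contribute nothing. -/
def graphOfMap (f : V → V) : SimpleGraph V := SimpleGraph.fromRel fun a b ↦ f a = b

lemma graphOfMap_adj {a b : V} : (graphOfMap f).Adj a b ↔ a ≠ b ∧ (f a = b ∨ f b = a) :=
  SimpleGraph.fromRel_adj _ _ _

/-- `f` is a parent map of `G` with root `r`: it fixes `r`, sends every other vertex to one of its
neighbours, and its iteration leads from every vertex to `r`. -/
structure IsParentMap (G : SimpleGraph V) (r : V) (f : V → V) : Prop where
  map_root : f r = r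
  adj : ∀ v, v ≠ r → G.Adj v (f v)
  reaches : ∀ v, ∃ k, f^[k] v = r

lemma IsParentMap.map_ne (h : G.IsParentMap r f) {v : V} (hv : v ≠ r) : f v ≠ v :=
  (h.adj v hv).ne'

lemma IsParentMap.graphOfMap_le (h : G.IsParentMap r f) : graphOfMap f ≤ G := by
  intro a b hab
  obtain ⟨hne, rfl | rfl⟩ := graphOfMap_adj.1 hab
  · exact h.adj a fun ha ↦ hne (by rw [ha, h.map_root])
  · exact (h.adj b fun hb ↦ hne (by rw [hb, h.map_root])).symm

/-- A 2-cycle of a parent map would trap the iteration away from the root. -/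
lemma IsParentMap.not_two_cycle (h : G.IsParentMap r f) {v : V} (hv : v ≠ r) : f (f v) ≠ v := by
  intro h2
  obtain ⟨k, hk⟩ := h.reaches v
  have key : ∀ k, f^[k] v = v ∨ f^[k] v = f v := by
    intro k
    induction k with
    | zero => simp
    | succ k ih =>
      rw [Function.iterate_succ_apply']
      rcases ih with ih | ih <;> simp [ih, h2]
  rcases key k with h' | h'
  · exact hv (h'.symm.trans hk)
  · have : f v = r := h'.symm.trans hk
    rw [this, h.map_root] at h2
    exact hv h2.symm

lemma IsParentMap.graphOfMap_reachable (h : G.IsParentMap r f) (v : V) :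
    (graphOfMap f).Reachable v r := by
  obtain ⟨k, hk⟩ := h.reaches v
  induction k generalizing v with
  | zero => exact hk ▸ Reachable.refl _
  | succ k ih =>
    by_cases hv : f v = v
    · exact ih v (by rwa [Function.iterate_succ_apply, hv] at hk)
    · exact (Adj.reachable (graphOfMap_adj.2 ⟨Ne.symm hv, Or.inl rfl⟩)).trans (ih _ hk)

lemma IsParentMap.isTree_graphOfMap [Finite V] (h : G.IsParentMap r f) :
    (graphOfMap f).IsTree := by
  classical
  have := Fintype.ofFinite V
  have hc : (graphOfMap f).Connected :=
    { preconnected := fun a b ↦ (h.graphOfMap_reachable a).trans (h.graphOfMap_reachable b).symm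
      nonempty := ⟨r⟩ }
  refine isTree_iff_connected_and_card.2 ⟨hc, le_antisymm ?_ hc.card_vert_le_card_edgeSet_add_one⟩
  -- Every edge is `s(v, f v)` for some `v ≠ r`, so there are at most `|V| - 1` edges.
  have hsub : (graphOfMap f).edgeSet ⊆
      ((univ.erase r).image fun v ↦ s(v, f v) : Finset (Sym2 V)) := by
    intro e
    induction e with | _ a b
    intro hab
    rw [mem_edgeSet] at hab
    obtain ⟨hne, rfl | rfl⟩ := graphOfMap_adj.1 hab
    · exact mem_coe.2 (mem_image.2 ⟨a, by
        simpa using fun ha : a = r ↦ hne (by rw [ha, h.map_root]), rfl⟩)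
    · exact mem_coe.2 (mem_image.2 ⟨b, by
        simpa using fun hb : b = r ↦ hne (by rw [hb, h.map_root]), Sym2.eq_swap⟩)
  have h1 := Set.ncard_le_ncard hsub (Finset.finite_toSet _)
  rw [Set.ncard_coe_finset] at h1
  have h2 := h1.trans card_image_le
  rw [card_erase_of_mem (mem_univ r), card_univ] at h2
  have h3 : 0 < Fintype.card V := Fintype.card_pos_iff.2 ⟨r⟩
  rw [Nat.card_eq_fintype_card (α := V), Nat.card_coe_set_eq]
  omega

/-- A vertex where two parent maps of one and the same tree differ is followed, along either map,
by another such vertex; since the root is none, there are no such vertices. -/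
lemma IsParentMap.eq_of_graphOfMap_eq {G' : SimpleGraph V} (hf : G.IsParentMap r f)
    (hg : G'.IsParentMap r g) (h : graphOfMap f = graphOfMap g) : f = g := by
  have step : ∀ v, f v ≠ g v → f (g v) = v := by
    intro v hv
    have hvr : v ≠ r := by rintro rfl; exact hv (hf.map_root.trans hg.map_root.symm)
    have : (graphOfMap f).Adj v (g v) := by
      rw [h]; exact graphOfMap_adj.2 ⟨(hg.map_ne hvr).symm, Or.inl rfl⟩
    exact (graphOfMap_adj.1 this).2.resolve_left hv
  have stay : ∀ v, f v ≠ g v → f (g v) ≠ g (g v) := by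
    intro v hv h2
    have hvr : v ≠ r := by rintro rfl; exact hv (hf.map_root.trans hg.map_root.symm)
    exact hg.not_two_cycle hvr (h2.symm.trans (step v hv))
  funext v
  by_contra hv
  obtain ⟨k, hk⟩ := hg.reaches v
  have : f (g^[k] v) ≠ g (g^[k] v) := by
    clear hk
    induction k with
    | zero => exact hv
    | succ k ih => rw [Function.iterate_succ_apply']; exact stay _ ih
  rw [hk, hf.map_root, hg.map_root] at this
  exact this rfl

/-- In a tree, stepping towards the root is a parent map. -/
lemma IsTree.exists_isParentMap (hT : T.IsTree) (r : V) : ∃ f, T.IsParentMap r f := by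
  have hex : ∀ v, v ≠ r → ∃ w, T.Adj v w ∧ T.dist w r < T.dist v r := by
    intro v hv
    obtain ⟨p, hp⟩ := hT.connected.exists_walk_length_eq_dist v r
    cases p with
    | nil => exact absurd rfl hv
    | cons h q =>
      refine ⟨_, h, ?_⟩
      rw [← hp, Walk.length_cons]
      exact Nat.lt_succ_of_le (dist_le q)
  classical
  choose! f hadj hlt using hex
  let f' : V → V := fun v ↦ if v = r then r else f v
  have hf' : ∀ v, v ≠ r → f' v = f v := fun v hv ↦ if_neg hv
  refine ⟨f', if_pos rfl, fun v hv ↦ by rw [hf' v hv]; exact hadj v hv, fun v ↦ ?_⟩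
  induction hd : T.dist v r using Nat.strong_induction_on generalizing v with
  | _ d ih =>
    by_cases hv : v = r
    · exact ⟨0, hv⟩
    · obtain ⟨k, hk⟩ := ih _ (hd ▸ hlt v hv) (f v) rfl
      exact ⟨k + 1, by rw [Function.iterate_succ_apply, hf' v hv, hk]⟩

/-- Spanning trees correspond to parent maps with a given root. -/
lemma spanningTreeCount_eq_ncard_isParentMap [Finite V] (G : SimpleGraph V) (r : V) :
    G.spanningTreeCount = {f : V → V | G.IsParentMap r f}.ncard := by
  symm
  refine Set.ncard_congr (fun f _ ↦ graphOfMap f)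
    (fun f hf ↦ ⟨hf.graphOfMap_le, hf.isTree_graphOfMap⟩)
    (fun f g hf hg h ↦ hf.eq_of_graphOfMap_eq hg h) ?_
  rintro T ⟨hTG, hT⟩
  obtain ⟨f, hf⟩ := hT.exists_isParentMap r
  refine ⟨f, ⟨hf.map_root, fun v hv ↦ hTG (hf.adj v hv), hf.reaches⟩, ?_⟩
  exact (isTree_iff_minimal_connected.1 hT).eq_of_le hf.isTree_graphOfMap.connected hf.graphOfMap_le

end ParentMap

/-! ### The matrix-tree theorem -/

section MatrixTree

variable {V : Type*} [DecidableEq V] {R : Type*} [CommRing R]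

/-- The matrix whose row `v` is `e_v - e_{f v}` for `v ≠ r`, and whose row `r` is `e_r`. -/
def parentMatrix (R : Type*) [CommRing R] (r : V) (f : V → V) : Matrix V V R :=
  fun v ↦ if v = r then Pi.single r 1 else Pi.single v 1 - Pi.single (f v) 1

lemma parentMatrix_apply_of_ne {r v : V} {f : V → V} (hv : v ≠ r) :
    parentMatrix R r f v = Pi.single v 1 - Pi.single (f v) 1 := if_neg hv

variable [Fintype V] (G : SimpleGraph V) [DecidableRel G.Adj]

/-- Ordering the vertices by the number of steps to the root makes the matrix triangular. -/
lemma det_parentMatrix_of_reaches {r : V} {f : V → V} (hf : ∀ v, ∃ k, f^[k] v = r) :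
    (parentMatrix R r f).det = 1 := by
  let h : V → ℕ := fun v ↦ Nat.find (hf v)
  have hlt : ∀ v, v ≠ r → h (f v) < h v := by
    intro v hv
    have hspec : f^[h v] v = r := Nat.find_spec (hf v)
    obtain ⟨k, hk⟩ : ∃ k, h v = k + 1 :=
      Nat.exists_eq_succ_of_ne_zero fun h0 ↦ hv (by rw [h0] at hspec; exact hspec)
    rw [hk, Function.iterate_succ_apply] at hspec
    exact (Nat.find_min' (hf (f v)) hspec).trans_lt (by omega)
  have hzero : ∀ v w, v ≠ w → h v ≤ h w → parentMatrix R r f v w = 0 := by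
    intro v w hne hle
    by_cases hv : v = r
    · subst hv; simp [parentMatrix, hne.symm]
    · have : w ≠ f v := by rintro rfl; exact absurd (hlt v hv) (by omega)
      simp [parentMatrix_apply_of_ne hv, hne.symm, this]
  have hone : ∀ v, parentMatrix R r f v v = 1 := by
    intro v
    by_cases hv : v = r
    · subst hv; simp [parentMatrix]
    · have : v ≠ f v := fun h' ↦ absurd (hlt v hv) (by rw [← h']; omega)
      simp [parentMatrix_apply_of_ne hv, this]
  have htri : (parentMatrix R r f).BlockTriangular (OrderDual.toDual ∘ h) := by
    intro v w hvw
    have hvw : h v < h w := hvw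
    exact hzero v w (by rintro rfl; exact absurd hvw (by omega)) hvw.le
  rw [htri.det]
  refine prod_eq_one fun a _ ↦ ?_
  have : (parentMatrix R r f).toSquareBlock (OrderDual.toDual ∘ h) a = 1 := by
    ext ⟨v, hv⟩ ⟨w, hw⟩
    by_cases hvw : v = w
    · subst hvw; simp [toSquareBlock, toSquareBlockProp, hone]
    · have : h v = h w := OrderDual.toDual.injective (hv.trans hw.symm)
      simp [toSquareBlock, toSquareBlockProp, hvw, hzero v w hvw this.le]
  rw [this, det_one]

/-- The indicator vector of the vertices that never reach the root lies in the kernel. -/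
lemma det_parentMatrix_of_not_reaches [IsDomain R] {r : V} {f : V → V}
    (hf : ¬ ∀ v, ∃ k, f^[k] v = r) : (parentMatrix R r f).det = 0 := by
  classical
  push Not at hf
  obtain ⟨v₀, hv₀⟩ := hf
  let x : V → R := fun v ↦ if ∀ k, f^[k] v ≠ r then 1 else 0
  refine exists_mulVec_eq_zero_iff.1 ⟨x, fun h ↦ ?_, ?_⟩
  · have := congrFun h v₀
    simp [x, hv₀] at this
  ext v
  by_cases hv : v = r
  · have hx : x r = 0 := if_neg fun h ↦ h 0 rfl
    simp [mulVec, parentMatrix, hv, hx]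
  · have hx : x v = x (f v) := by
      have : (∀ k, f^[k] v ≠ r) ↔ ∀ k, f^[k] (f v) ≠ r := by
        refine ⟨fun h k ↦ h (k + 1), fun h k ↦ ?_⟩
        cases k with
        | zero => exact hv
        | succ k => exact h k
      simp only [x, this]
    rw [mulVec, parentMatrix_apply_of_ne hv, sub_dotProduct]
    simp [hx]

lemma lapMatrix_row (v : V) :
    G.lapMatrix R v = ∑ w ∈ G.neighborFinset v, (Pi.single v 1 - Pi.single w 1) := by
  ext w
  simp [lapMatrix, degMatrix, Finset.sum_apply, diagonal_apply, Pi.single_apply, adjMatrix_apply,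
    eq_comm]

/-- **Kirchhoff's matrix-tree theorem**: the cofactor of the Laplacian matrix at a diagonal entry
is the number of spanning trees. -/
theorem det_updateRow_lapMatrix_single [IsDomain R] (r : V) :
    ((G.lapMatrix R).updateRow r (Pi.single r 1)).det = G.spanningTreeCount := by
  classical
  -- Row `v` is a sum over the neighbours of `v`, so the determinant is a sum over the choices of
  -- one neighbour for each vertex.
  let S : V → Finset V := fun v ↦ if v = r then {r} else G.neighborFinset v
  let g : V → V → V → R := fun v w ↦
    if v = r then Pi.single r 1 else Pi.single v 1 - Pi.single w 1
  have hrows : (G.lapMatrix R).updateRow r (Pi.single r 1) = fun v ↦ ∑ w ∈ S v, g v w := by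
    funext v
    by_cases hv : v = r
    · subst hv; simp [S, g]
    · rw [updateRow_ne hv, lapMatrix_row]; simp [S, g, hv]
  have hS : ∀ f : V → V, f ∈ Fintype.piFinset S ↔ f r = r ∧ ∀ v, v ≠ r → G.Adj v (f v) := by
    intro f
    rw [Fintype.mem_piFinset]
    constructor
    · refine fun h ↦ ⟨by simpa [S] using h r, fun v hv ↦ by simpa [S, hv] using h v⟩
    · rintro ⟨h1, h2⟩ v
      by_cases hv : v = r
      · simp [S, hv, h1]
      · simpa [S, hv] using h2 v hv
  have key := (detRowAlternating (n := V) (R := R)).toMultilinearMap.map_sum_finset g S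
  have hdet : ((G.lapMatrix R).updateRow r (Pi.single r 1)).det =
      ∑ f ∈ Fintype.piFinset S, (parentMatrix R r f).det := by
    rw [hrows]; exact key
  rw [hdet, spanningTreeCount_eq_ncard_isParentMap G r]
  have hval : ∀ f : V → V, (parentMatrix R r f).det = if ∀ v, ∃ k, f^[k] v = r then 1 else 0 := by
    intro f
    split_ifs with h
    · exact det_parentMatrix_of_reaches h
    · exact det_parentMatrix_of_not_reaches h
  simp_rw [hval]
  rw [sum_boole, ← Set.ncard_coe_finset]
  congr 2
  ext f
  simp only [coe_filter, hS, Set.mem_ofPred_eq]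
  exact ⟨fun ⟨⟨h1, h2⟩, h3⟩ ↦ ⟨h1, h2, h3⟩, fun h ↦ ⟨⟨h.map_root, h.adj⟩, h.reaches⟩⟩

lemma det_lapMatrix [IsDomain R] [Nonempty V] : (G.lapMatrix R).det = 0 :=
  exists_mulVec_eq_zero_iff.1
    ⟨fun _ ↦ 1, fun h ↦ one_ne_zero (congrFun h (Classical.arbitrary V)),
      G.lapMatrix_mulVec_const_eq_zero⟩

/-- Two choices of the new row with the same sum give the same determinant: with the difference as
row `r`, all row sums vanish. -/
lemma det_updateRow_lapMatrix [IsDomain R] (r : V) (v : V → R) :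
    ((G.lapMatrix R).updateRow r v).det = (∑ i, v i) * G.spanningTreeCount := by
  have h0 : ((G.lapMatrix R).updateRow r (v - (∑ i, v i) • Pi.single r 1)).det = 0 := by
    refine exists_mulVec_eq_zero_iff.1 ⟨fun _ ↦ 1, fun h ↦ one_ne_zero (congrFun h r), ?_⟩
    ext i
    by_cases hi : i = r
    · subst hi; simp [mulVec, dotProduct, Pi.single_apply]
    · have := congrFun (G.lapMatrix_mulVec_const_eq_zero (R := R)) i
      simpa [mulVec, updateRow_ne hi] using this
  have h1 : v = (v - (∑ i, v i) • Pi.single r 1) + (∑ i, v i) • Pi.single r 1 := by simp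
  conv_lhs => rw [h1]
  rw [det_updateRow_add, h0, det_updateRow_smul, det_updateRow_lapMatrix_single, zero_add]

/-- Rank-one perturbations of the Laplacian matrix count spanning trees. -/
theorem det_lapMatrix_add_vecMulVec [IsDomain R] [Nonempty V] (u v : V → R) :
    (G.lapMatrix R + vecMulVec u v).det = (∑ i, u i) * (∑ i, v i) * G.spanningTreeCount := by
  rw [det_add_vecMulVec_eq_sum_updateRow, det_lapMatrix, zero_add, sum_mul, sum_mul]
  simp_rw [det_updateRow_lapMatrix, mul_assoc]

end MatrixTree

/-! ### Laplacian eigenvalues -/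

section Spectrum

variable {V : Type*} [Fintype V] [DecidableEq V] (G : SimpleGraph V) [DecidableRel G.Adj]

/-- The characteristic polynomial at `-x`, up to sign. -/
lemma det_smul_one_add_lapMatrix (x : ℝ) :
    (x • (1 : Matrix V V ℝ) + G.lapMatrix ℝ).det = ∏ i, (x + G.lapEigenvalue i) := by
  have hL := G.isHermitian_lapMatrix ℝ
  have h1 : (x • (1 : Matrix V V ℝ) + G.lapMatrix ℝ).det =
      (-1) ^ Fintype.card V * (G.lapMatrix ℝ).charpoly.eval (-x) := by
    rw [eval_charpoly, ← det_neg]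
    congr 1
    ext i j
    by_cases hij : i = j <;> simp [hij, add_comm]
  have h2 : (G.lapMatrix ℝ).charpoly.eval (-x) = ∏ i, (-1) * (x + hL.eigenvalues i) := by
    rw [hL.charpoly_eq, Polynomial.eval_prod]
    refine prod_congr rfl fun i _ ↦ ?_
    simp only [RCLike.ofReal_real_eq_id, id_eq, Polynomial.eval_sub, Polynomial.eval_X,
      Polynomial.eval_C]
    ring
  rw [h1, h2, prod_mul_distrib, prod_const, card_univ, ← mul_assoc, ← mul_pow]
  simp only [mul_neg, mul_one, neg_neg, one_pow, one_mul]
  let e : Fin (Fintype.card V) ≃ V := Fintype.equivOfCardEq (Fintype.card_fin _)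
  refine Fintype.prod_equiv (e.symm.trans Fin.revPerm) _ _ fun i ↦ ?_
  simp [lapEigenvalue, IsHermitian.eigenvalues, e]

/-- The least eigenvalue of the Laplacian matrix is `0`: no eigenvalue is negative, and their
product vanishes. -/
lemma lapEigenvalue_zero (h : 0 < Fintype.card V) : G.lapEigenvalue ⟨0, h⟩ = 0 := by
  have : Nonempty V := Fintype.card_pos_iff.1 h
  have hL := G.isHermitian_lapMatrix ℝ
  have hprod := G.det_smul_one_add_lapMatrix 0
  rw [zero_smul, zero_add, det_lapMatrix] at hprod
  obtain ⟨i, -, hi⟩ := prod_eq_zero_iff.1 hprod.symm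
  rw [zero_add] at hi
  refine le_antisymm ?_ ?_
  · rw [← hi]
    exact hL.eigenvalues₀_antitone (Fin.rev_le_rev.2 (Fin.mk_le_of_le_val (Nat.zero_le _)))
  · let e : Fin (Fintype.card V) ≃ V := Fintype.equivOfCardEq (Fintype.card_fin _)
    have h2 := (G.posSemidef_lapMatrix ℝ).eigenvalues_nonneg (e (Fin.rev ⟨0, h⟩))
    simpa [IsHermitian.eigenvalues, e, lapEigenvalue] using h2

lemma det_smul_one_add_lapMatrix_eq_mul_prod [Nonempty V] (x : ℝ) :
    (x • (1 : Matrix V V ℝ) + G.lapMatrix ℝ).det =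
      x * ∏ i : Fin (Fintype.card V) with 1 ≤ i.val, (x + G.lapEigenvalue i) := by
  have h : 0 < Fintype.card V := Fintype.card_pos
  have hset : (univ.filter fun i : Fin (Fintype.card V) ↦ 1 ≤ i.val) = univ.erase ⟨0, h⟩ := by
    ext i
    simp only [mem_filter, mem_univ, true_and, mem_erase, ne_eq, Fin.ext_iff, and_true]
    omega
  rw [det_smul_one_add_lapMatrix, hset, ← mul_prod_erase univ _ (mem_univ ⟨0, h⟩),
    lapEigenvalue_zero, add_zero]

end Spectrum

/-! ### The subdivision-vertex join -/

section Adjacency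

variable {V W : Type*} (G₁ : SimpleGraph V) (G₂ : SimpleGraph W)

lemma subdivisionVertexJoin_adj_vertex_vertex (x x' : V) :
    (G₁.subdivisionVertexJoin G₂).Adj (.inl (.inl x)) (.inl (.inl x')) ↔ False := Iff.rfl

lemma subdivisionVertexJoin_adj_vertex_edge (x : V) (e : G₁.edgeSet) :
    (G₁.subdivisionVertexJoin G₂).Adj (.inl (.inl x)) (.inl (.inr e)) ↔ x ∈ e.1 := Iff.rfl

lemma subdivisionVertexJoin_adj_edge_vertex (x : V) (e : G₁.edgeSet) :
    (G₁.subdivisionVertexJoin G₂).Adj (.inl (.inr e)) (.inl (.inl x)) ↔ x ∈ e.1 := Iff.rfl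

lemma subdivisionVertexJoin_adj_edge_edge (e e' : G₁.edgeSet) :
    (G₁.subdivisionVertexJoin G₂).Adj (.inl (.inr e)) (.inl (.inr e')) ↔ False := Iff.rfl

lemma subdivisionVertexJoin_adj_vertex_right (x : V) (y : W) :
    (G₁.subdivisionVertexJoin G₂).Adj (.inl (.inl x)) (.inr y) ↔ True := Iff.rfl

lemma subdivisionVertexJoin_adj_right_vertex (x : V) (y : W) :
    (G₁.subdivisionVertexJoin G₂).Adj (.inr y) (.inl (.inl x)) ↔ True := Iff.rfl

lemma subdivisionVertexJoin_adj_edge_right (e : G₁.edgeSet) (y : W) :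
    (G₁.subdivisionVertexJoin G₂).Adj (.inl (.inr e)) (.inr y) ↔ False := Iff.rfl

lemma subdivisionVertexJoin_adj_right_edge (e : G₁.edgeSet) (y : W) :
    (G₁.subdivisionVertexJoin G₂).Adj (.inr y) (.inl (.inr e)) ↔ False := Iff.rfl

lemma subdivisionVertexJoin_adj_right_right (y y' : W) :
    (G₁.subdivisionVertexJoin G₂).Adj (.inr y) (.inr y') ↔ G₂.Adj y y' := Iff.rfl

end Adjacency

section Join

variable {V W : Type*} [DecidableEq V]

/-- The vertex-edge incidence matrix, with columns indexed by the edges of the graph only (the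
columns of `SimpleGraph.incMatrix` are indexed by all unordered pairs). -/
def edgeIncMatrix (G : SimpleGraph V) [DecidableRel G.Adj] : Matrix V G.edgeSet ℝ :=
  (G.incMatrix ℝ).submatrix id (↑)

lemma edgeIncMatrix_apply (G : SimpleGraph V) [DecidableRel G.Adj] (x : V) (e : G.edgeSet)
    [Decidable (x ∈ e.1)] : G.edgeIncMatrix x e = if x ∈ e.1 then 1 else 0 := by
  simp [edgeIncMatrix, incMatrix_apply', incidenceSet, e.2]

variable [Fintype V] [Fintype W] [DecidableEq W]

lemma sum_ends_eq_two (G : SimpleGraph V) {e : Sym2 V} (he : e ∈ G.edgeSet)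
    [∀ x, Decidable (x ∈ e)] : (∑ x, if x ∈ e then (1 : ℝ) else 0) = 2 := by
  have : (univ.filter fun x : V ↦ x ∈ e) = e.toFinset := by ext; simp
  rw [sum_boole, this, Sym2.card_toFinset_of_not_isDiag e (G.not_isDiag_of_mem_edgeSet he),
    Nat.cast_two]

variable (G₁ : SimpleGraph V) [DecidableRel G₁.Adj] (G₂ : SimpleGraph W) [DecidableRel G₂.Adj]

lemma edgeIncMatrix_mul_transpose :
    G₁.edgeIncMatrix * G₁.edgeIncMatrixᵀ = G₁.degMatrix ℝ + G₁.adjMatrix ℝ := by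
  have h1 : G₁.edgeIncMatrix * G₁.edgeIncMatrixᵀ = G₁.incMatrix ℝ * (G₁.incMatrix ℝ)ᵀ := by
    ext x y
    simp only [mul_apply, transpose_apply, edgeIncMatrix, submatrix_apply, id_eq]
    rw [← Finset.sum_subtype G₁.edgeFinset (fun e ↦ mem_edgeFinset)
      (fun e ↦ G₁.incMatrix ℝ x e * G₁.incMatrix ℝ y e)]
    refine sum_subset (subset_univ _) fun e _ he ↦ ?_
    rw [incMatrix_of_notMem_incidenceSet G₁ fun h ↦ he (mem_edgeFinset.2 h.1), zero_mul]
  rw [h1, incMatrix_mul_transpose]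
  ext x y
  by_cases hxy : x = y
  · subst hxy; simp [degMatrix]
  · simp [degMatrix, hxy, adjMatrix_apply]

lemma sum_edges_eq_degree (x : V) [∀ e : G₁.edgeSet, Decidable (x ∈ e.1)] :
    (∑ e : G₁.edgeSet, if x ∈ e.1 then (1 : ℝ) else 0) = G₁.degree x := by
  have := congrFun (congrFun G₁.edgeIncMatrix_mul_transpose x) x
  simpa [mul_apply, edgeIncMatrix_apply, degMatrix, ← ite_and] using this

/-- Adding `1` to the entries whose row belongs to `G₂` and whose column belongs to `V(G₁)` cancels
the lower left block of the Laplacian matrix of the join. -/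
lemma lapMatrix_subdivisionVertexJoin_add [DecidableRel (G₁.subdivisionVertexJoin G₂).Adj] :
    (G₁.subdivisionVertexJoin G₂).lapMatrix ℝ +
        vecMulVec (Sum.elim 0 1) (Sum.elim (Sum.elim 1 0) 0) =
      fromBlocks
        (fromBlocks (G₁.degMatrix ℝ + (Fintype.card W : ℝ) • 1) (-G₁.edgeIncMatrix)
          (-G₁.edgeIncMatrixᵀ) ((2 : ℝ) • 1))
        (of (Sum.elim (fun _ _ ↦ -1) fun _ _ ↦ 0)) 0
        ((Fintype.card V : ℝ) • 1 + G₂.lapMatrix ℝ) := by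
  ext a b
  rw [Matrix.add_apply, lapMatrix, Matrix.sub_apply, degMatrix, diagonal_apply,
    degree_eq_sum_if_adj, adjMatrix_apply]
  -- The off-diagonal blocks are immediate; in the diagonal blocks the degrees of the vertices of the
  -- join remain to be identified.
  obtain (x | e) | y := a <;> obtain (x' | e') | y' := b <;>
    simp [Fintype.sum_sum_type, subdivisionVertexJoin_adj_vertex_vertex,
      subdivisionVertexJoin_adj_vertex_edge, subdivisionVertexJoin_adj_edge_vertex,
      subdivisionVertexJoin_adj_edge_edge, subdivisionVertexJoin_adj_vertex_right,
      subdivisionVertexJoin_adj_right_vertex, subdivisionVertexJoin_adj_edge_right,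
      subdivisionVertexJoin_adj_right_edge, subdivisionVertexJoin_adj_right_right, vecMulVec_apply,
      edgeIncMatrix_apply, lapMatrix, degMatrix, diagonal_apply, Matrix.one_apply,
      adjMatrix_apply, -sum_boole]
  · by_cases h : x = x'
    · rw [if_pos h, if_pos h, if_pos h, sum_edges_eq_degree]
    · simp [h]
  · by_cases h : e = e'
    · rw [if_pos h, if_pos h, sum_ends_eq_two G₁ e.2]
    · simp [h]
  · by_cases h : y = y'
    · rw [if_pos h, if_pos h, if_pos h, degree_eq_sum_if_adj]; ring
    · simp [h]

/-- The Schur complement of the block of the inserted vertices is half of a shifted Laplacian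
matrix of the original graph. -/
lemma det_subdivision_block (c : ℝ) :
    (fromBlocks (G₁.degMatrix ℝ + c • 1) (-G₁.edgeIncMatrix)
        (-G₁.edgeIncMatrixᵀ) ((2 : ℝ) • (1 : Matrix G₁.edgeSet G₁.edgeSet ℝ))).det =
      (2 : ℝ) ^ ((#G₁.edgeFinset : ℤ) - (Fintype.card V : ℤ)) *
        ((2 * c) • (1 : Matrix V V ℝ) + G₁.lapMatrix ℝ).det := by
  let : Invertible ((2 : ℝ) • (1 : Matrix G₁.edgeSet G₁.edgeSet ℝ)) :=
    ⟨(2⁻¹ : ℝ) • 1, by simp, by simp⟩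
  have hinv : ⅟((2 : ℝ) • (1 : Matrix G₁.edgeSet G₁.edgeSet ℝ)) = (2⁻¹ : ℝ) • 1 := rfl
  have hschur : G₁.degMatrix ℝ + c • 1 -
      -G₁.edgeIncMatrix * ⅟((2 : ℝ) • (1 : Matrix G₁.edgeSet G₁.edgeSet ℝ)) *
        -G₁.edgeIncMatrixᵀ =
      (2⁻¹ : ℝ) • ((2 * c) • (1 : Matrix V V ℝ) + G₁.lapMatrix ℝ) := by
    rw [hinv, Matrix.mul_smul, Matrix.mul_one, Matrix.smul_mul, Matrix.neg_mul, Matrix.mul_neg, neg_neg,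
      edgeIncMatrix_mul_transpose, lapMatrix]
    module
  rw [det_fromBlocks₂₂, hschur, det_smul, det_smul, det_one, mul_one, zpow_sub₀ two_ne_zero,
    zpow_natCast, zpow_natCast, edgeFinset_card, inv_pow]
  ring

/-- The spanning tree count in determinant form; `G₁` need not be regular here. -/
theorem card_mul_card_mul_spanningTreeCount_subdivisionVertexJoin [Nonempty V] :
    (Fintype.card W * Fintype.card V * (G₁.subdivisionVertexJoin G₂).spanningTreeCount : ℝ) =
      (2 : ℝ) ^ ((#G₁.edgeFinset : ℤ) - (Fintype.card V : ℤ)) *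
        ((2 * Fintype.card W : ℝ) • (1 : Matrix V V ℝ) + G₁.lapMatrix ℝ).det *
        ((Fintype.card V : ℝ) • (1 : Matrix W W ℝ) + G₂.lapMatrix ℝ).det := by
  classical
  have h := (G₁.subdivisionVertexJoin G₂).det_lapMatrix_add_vecMulVec (R := ℝ)
    (Sum.elim 0 1) (Sum.elim (Sum.elim 1 0) 0)
  rw [lapMatrix_subdivisionVertexJoin_add, det_fromBlocks_zero₂₁, det_subdivision_block] at h
  rw [h]
  simp

end Join

lemma IsRegularOfDegree.two_mul_card_edgeFinset {V : Type*} [Fintype V]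
    {G : SimpleGraph V} [DecidableRel G.Adj] {r : ℕ}
    (h : G.IsRegularOfDegree r) : 2 * #G.edgeFinset = Fintype.card V * r := by
  rw [← G.sum_degrees_eq_twice_card_edges]
  simp [h.degree_eq]

end SimpleGraph

theorem mainTheorem7 {V W : Type*} [Fintype V] [DecidableEq V] [Nonempty V]
    [Fintype W] [DecidableEq W] [Nonempty W]
    (G₁ : SimpleGraph V) [DecidableRel G₁.Adj] (G₂ : SimpleGraph W) [DecidableRel G₂.Adj]
    (n₁ m₁ r₁ n₂ : ℕ)
    (hn₁ : Fintype.card V = n₁) (hm₁ : G₁.edgeFinset.card = m₁)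
    (hr₁ : G₁.IsRegularOfDegree r₁) (hn₂ : Fintype.card W = n₂) :
    ((G₁.subdivisionVertexJoin G₂).spanningTreeCount : ℝ) =
      ((2 : ℝ) ^ ((m₁ : ℤ) - (n₁ : ℤ)) * (2 * (n₁ : ℝ) + 2 * (n₂ : ℝ) + (n₁ : ℝ) * (r₁ : ℝ)) *
        (∏ i : Fin (Fintype.card W) with 1 ≤ i.val, ((n₁ : ℝ) + G₂.lapEigenvalue i)) *
        (∏ i : Fin (Fintype.card V) with 1 ≤ i.val, (2 * (n₂ : ℝ) + G₁.lapEigenvalue i))) /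
      ((m₁ : ℝ) + (n₁ : ℝ) + (n₂ : ℝ)) := by
  subst hn₁ hn₂ hm₁
  have h := G₁.card_mul_card_mul_spanningTreeCount_subdivisionVertexJoin G₂
  have hreg := hr₁.two_mul_card_edgeFinset
  rw [SimpleGraph.det_smul_one_add_lapMatrix_eq_mul_prod,
    SimpleGraph.det_smul_one_add_lapMatrix_eq_mul_prod] at h
  have hreg' : (Fintype.card V : ℝ) * r₁ = 2 * G₁.edgeFinset.card := by exact_mod_cast hreg.symm
  have h1 : (0 : ℝ) < Fintype.card V := by exact_mod_cast Fintype.card_pos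
  have h2 : (0 : ℝ) < Fintype.card W := by exact_mod_cast Fintype.card_pos
  -- The factor `2 n₁ + 2 n₂ + n₁ r₁` is twice the denominator, the number of vertices of the join.
  rw [eq_div_iff (by positivity), hreg']
  refine mul_left_cancel₀ (mul_pos h2 h1).ne' ?_
  linear_combination ((G₁.edgeFinset.card : ℝ) + Fintype.card V + Fintype.card W) * h
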